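/- Let $H\in(1/2,1)$ and let $B=(B_t)_{t\in[0,1]}$ be a fractional Brownian motion with Hurst parameter $H$ on a probability space $(\Omega,\mathcal F,P)$, i.e. a continuous centered Gaussian process with covariance $\frac12\left(s^{2H}+t^{2H}-|t-s|^{2H}\right)$. Let $x_0\in\mathbb R$, let $a\in C^2(\mathbb R)$ and $\sigma\in C^3(\mathbb R)$ be bounded, with bounded derivatives up to order $2$ and $3$ respectively, and let $\inf_{x\in\mathbb R}\sigma(x)>0$. Let $X=(X_t)_{t\in[0,1]}$ be the solution with continuous paths of $$X_t=x_0+\int_0^t a(X_\tau)\,d\tau+\int_0^t\sigma(X_\tau)\,dB_\tau,\qquad t\in[0,1],$$ where the integral with respect to $B$ is a pathwise Riemann–Stieltjes integral. For $n\ge 1$ let $\Delta=1/n$, $\Delta_kB=B_{(k+1)/n}-B_{k/n}$, and let McShane's scheme be given by $\widehat X^{(n)}_0=x_0$ and, for $k=0,\dots,n-1$, $$\begin{aligned}\widehat X^{(n)}_{k+1}=\widehat X^{(n)}_k&+a(\widehat X^{(n)}_k)\Delta+\sigma(\widehat X^{(n)}_k)\Delta_kB+\tfrac12\sigma\sigma'(\widehat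 X^{(n)}_k)(\Delta_kB)^2\\&+\tfrac12(a\sigma'+a'\sigma)(\widehat X^{(n)}_k)\,\Delta_kB\,\Delta+\tfrac12aa'(\widehat X^{(n)}_k)\Delta^2\\&+\tfrac16\left(\sigma^2\sigma''+\sigma(\sigma')^2\right)(\widehat X^{(n)}_k)(\Delta_kB)^3.\end{aligned}$$ If $(a'\sigma-a\sigma')(x)=0$ for all $x\in\mathbb R$, then there is a constant $C=C(a,\sigma,x_0,H)>0$ such that $X_1-\widehat X^{(n)}_n\in L^2(P)$ and $$\left(\mathbf E\,|X_1-\widehat X^{(n)}_n|^2\right)^{1/2}\le C\,n^{-2H}\qquad\text{for all integers } n\ge1.$$ -/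

import Mathlib

open MeasureTheory ProbabilityTheory

/-- `I` is the Riemann-Stieltjes integral of `f` with respect to `g` over `[s, t]`, where `s ≤ t`:
the limit of the sums `∑ f (ξ i) * (g (τ (i+1)) - g (τ i))` over the tagged partitions
`s = τ 0 ≤ τ 1 ≤ ... ≤ τ m = t`, `ξ i ∈ [τ i, τ (i+1)]`, as the mesh tends to zero. -/
def HasRSIntegral (f g : ℝ → ℝ) (s t I : ℝ) : Prop :=
  ∀ ε : ℝ, 0 < ε → ∃ δ : ℝ, 0 < δ ∧ ∀ (m : ℕ) (τ ξ : ℕ → ℝ),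
    τ 0 = s → τ m = t →
    (∀ i < m, τ i ≤ τ (i + 1)) →
    (∀ i < m, τ (i + 1) - τ i < δ) →
    (∀ i < m, ξ i ∈ Set.Icc (τ i) (τ (i + 1))) →
    |(∑ i ∈ Finset.range m, f (ξ i) * (g (τ (i + 1)) - g (τ i))) - I| < ε

/-- `B` (restricted to `[0, 1]`) is a fractional Brownian motion with Hurst parameter `H` under
`P`: a centered Gaussian process with (almost surely) continuous paths and covariance
`(s ^ (2H) + t ^ (2H) - |t - s| ^ (2H)) / 2`. -/
structure IsFractionalBrownianMotion {Ω : Type*} [MeasurableSpace Ω] (P : Measure Ω) (H : ℝ)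
    (B : ℝ → Ω → ℝ) : Prop where
  gaussian : IsGaussianProcess (fun t : Set.Icc (0 : ℝ) 1 => B t) P
  centered : ∀ t ∈ Set.Icc (0 : ℝ) 1, ∫ ω, B t ω ∂P = 0
  covariance_eq : ∀ s ∈ Set.Icc (0 : ℝ) 1, ∀ t ∈ Set.Icc (0 : ℝ) 1,
    ∫ ω, B s ω * B t ω ∂P = 1 / 2 * (s ^ (2 * H) + t ^ (2 * H) - |t - s| ^ (2 * H))
  continuous_paths : ∀ᵐ ω ∂P, ContinuousOn (fun t => B t ω) (Set.Icc 0 1)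

/-- `X` solves `dX = a(X) dt + σ(X) dB` on `[0, 1]` with `X_0 = x₀`: almost surely the path of `X`
is continuous and, for every `t ∈ [0, 1]`, the Riemann-Stieltjes integral `∫_0^t σ(X) dB` exists
and equals `X_t - x₀ - ∫_0^t a(X_τ) dτ`. -/
def IsPathwiseSolution {Ω : Type*} [MeasurableSpace Ω] (P : Measure Ω) (a σ : ℝ → ℝ) (x₀ : ℝ)
    (B X : ℝ → Ω → ℝ) : Prop :=
  ∀ᵐ ω ∂P, ContinuousOn (fun t => X t ω) (Set.Icc 0 1) ∧
    ∀ t ∈ Set.Icc (0 : ℝ) 1, ∃ I : ℝ,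
      HasRSIntegral (fun r => σ (X r ω)) (fun r => B r ω) 0 t I ∧
      X t ω = x₀ + (∫ r in (0 : ℝ)..t, a (X r ω)) + I

/-- One step of McShane's scheme from the point `x`, with step size `h` and increment `b` of the
driving path. -/
noncomputable def mcShaneStep (a σ : ℝ → ℝ) (h b x : ℝ) : ℝ :=
  x + a x * h + σ x * b
    + 1 / 2 * (σ x * deriv σ x) * b ^ 2
    + 1 / 2 * (a x * deriv σ x + deriv a x * σ x) * b * h
    + 1 / 2 * (a x * deriv a x) * h ^ 2
    + 1 / 6 * (σ x ^ 2 * iteratedDeriv 2 σ x + σ x * deriv σ x ^ 2) * b ^ 3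

/-- McShane's scheme with step size `1 / n` along the path `B`; the last argument is the step. -/
noncomputable def mcShane (a σ : ℝ → ℝ) (x₀ : ℝ) (B : ℝ → ℝ) (n : ℕ) : ℕ → ℝ
  | 0 => x₀
  | k + 1 => mcShaneStep a σ (1 / (n : ℝ)) (B (((k : ℝ) + 1) / n) - B ((k : ℝ) / n))
      (mcShane a σ x₀ B n k)

/-! The condition says that `a / σ` has zero derivative, so `a = c σ` for a constant `c`, and the
equation becomes `dX = σ(X) d(ct + B)`. Let `Λ` be a primitive of `1 / σ` and `φ` its inverse, so
that `φ' = σ ∘ φ`. In the coordinate `Λ` the equation is a translation, whence `X_1 = φ (Λ x₀ + c +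
B_1 - B_0)` almost surely (`ae_solution_eq`).

With `a = c σ`, a McShane step of size `h` and increment `b` is the cubic Taylor polynomial of `φ`
at `u = c h + b`, except that its cubic term carries `b ^ 3` in place of `u ^ 3`. In the coordinate
`Λ` the local error is therefore `O(b ^ 4 + b ^ 2 h + h ^ 3)` (`exists_abs_mcShaneStep_sub_le`). The
exact motion being a translation there, local errors simply add up and no Gronwall argument is
needed (`abs_flow_sub_mcShane_le`). Gaussian moments with `E b ^ 2 = n ^ (-2H)` bound the `L²` norm
of the sum by a multiple of `n ^ (-2H)`.

The formula for `X_1` is proved without a change-of-variables theorem. The increments of `Λ(X)` over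
a grid are expanded to second order; the Saks-Henstock lemma makes the total first-order error
small, and the quadratic remainder vanishes because fractional Brownian motion with `H > 1 / 2` has
zero quadratic variation along a subsequence of grids. -/

/-! ### Tagged Riemann-Stieltjes sums and their concatenation. -/

/-- `RSSum f g δ s t S` says that `S` is a Riemann-Stieltjes sum of `f` with respect to `g` for some
tagged partition of `[s, t]` whose mesh is less than `δ`. -/
inductive RSSum (f g : ℝ → ℝ) (δ s : ℝ) : ℝ → ℝ → Prop
  | nil : RSSum f g δ s s 0
  | snoc {t u S ξ : ℝ} : RSSum f g δ s t S → t ≤ u → u - t < δ → ξ ∈ Set.Icc t u →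
      RSSum f g δ s u (S + f ξ * (g u - g t))

namespace RSSum

variable {f g : ℝ → ℝ} {δ s t u S S' : ℝ}

theorem exists_partition (h : RSSum f g δ s t S) :
    ∃ (m : ℕ) (τ ξ : ℕ → ℝ), τ 0 = s ∧ τ m = t ∧ (∀ i < m, τ i ≤ τ (i + 1)) ∧
      (∀ i < m, τ (i + 1) - τ i < δ) ∧ (∀ i < m, ξ i ∈ Set.Icc (τ i) (τ (i + 1))) ∧
      ∑ i ∈ Finset.range m, f (ξ i) * (g (τ (i + 1)) - g (τ i)) = S := by
  induction h with
  | nil => exact ⟨0, fun _ => s, fun _ => s, rfl, rfl, by simp, by simp, by simp, by simp⟩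
  | @snoc t u S x _ htu hδ hx ih =>
    obtain ⟨m, τ, ξ, h0, hm, hle, hmesh, htag, hsum⟩ := ih
    refine ⟨m + 1, fun i => if i ≤ m then τ i else u, fun i => if i < m then ξ i else x,
      by simpa using h0, by simp, ?_, ?_, ?_, ?_⟩
    · intro i hi
      rcases Nat.lt_succ_iff_lt_or_eq.1 hi with h | rfl
      · simpa [h.le, Nat.succ_le_of_lt h] using hle i h
      · simpa [hm] using htu
    · intro i hi
      rcases Nat.lt_succ_iff_lt_or_eq.1 hi with h | rfl
      · simpa [h.le, Nat.succ_le_of_lt h] using hmesh i h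
      · simpa [hm] using hδ
    · intro i hi
      rcases Nat.lt_succ_iff_lt_or_eq.1 hi with h | rfl
      · simpa [h, h.le, Nat.succ_le_of_lt h] using htag i h
      · simpa [hm] using hx
    · rw [Finset.sum_range_succ, ← hsum]
      congr 1
      · refine Finset.sum_congr rfl fun i hi => ?_
        have h := Finset.mem_range.1 hi
        simp [h, h.le, Nat.succ_le_of_lt h]
      · simp [hm]

theorem trans (h : RSSum f g δ s t S) (h' : RSSum f g δ t u S') :
    RSSum f g δ s u (S + S') := by
  induction h' with
  | nil => simpa using h
  | snoc _ h1 h2 h3 ih =>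
    rw [← add_assoc]
    exact ih.snoc h1 h2 h3

theorem mono {δ' : ℝ} (hδ : δ ≤ δ') (h : RSSum f g δ s t S) : RSSum f g δ' s t S := by
  induction h with
  | nil => exact .nil
  | snoc _ h1 h2 h3 ih => exact ih.snoc h1 (h2.trans_le hδ) h3

theorem single {ξ : ℝ} (h1 : s ≤ t) (h2 : t - s < δ) (h3 : ξ ∈ Set.Icc s t) :
    RSSum f g δ s t (f ξ * (g t - g s)) := by
  simpa using (RSSum.nil (s := s)).snoc h1 h2 h3

theorem sum {p T : ℕ → ℝ} {n : ℕ} (h : ∀ k < n, RSSum f g δ (p k) (p (k + 1)) (T k)) :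
    RSSum f g δ (p 0) (p n) (∑ k ∈ Finset.range n, T k) := by
  induction n with
  | zero => simpa using RSSum.nil (s := p 0)
  | succ n ih =>
    rw [Finset.sum_range_succ]
    exact (ih fun k hk => h k (by omega)).trans (h n (by omega))

theorem exists_of_le (hst : s ≤ t) (hδ : 0 < δ) : ∃ S, RSSum f g δ s t S := by
  obtain ⟨m, hm⟩ := exists_nat_gt ((t - s) / δ)
  have hm0 : (0 : ℝ) < m := lt_of_le_of_lt (div_nonneg (sub_nonneg.2 hst) hδ.le) hm
  have hh : (t - s) / m < δ := by
    rw [div_lt_iff₀ hδ] at hm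
    rw [div_lt_iff₀ hm0]
    linarith
  have hh0 : 0 ≤ (t - s) / m := div_nonneg (sub_nonneg.2 hst) hm0.le
  have key := RSSum.sum (f := f) (g := g) (δ := δ) (p := fun i => s + i * ((t - s) / m)) (n := m)
    (fun k _ => RSSum.single (by push_cast; nlinarith) (by push_cast; nlinarith)
      (Set.left_mem_Icc.2 (by push_cast; nlinarith)))
  have e0 : s + ((0 : ℕ) : ℝ) * ((t - s) / m) = s := by simp
  have e1 : s + (m : ℝ) * ((t - s) / m) = t := by field_simp; ring
  rw [e0, e1] at key
  exact ⟨_, key⟩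

end RSSum

/-! ### Riemann-Stieltjes integrals and the Saks-Henstock lemma. -/

namespace HasRSIntegral

variable {f g : ℝ → ℝ} {s t I : ℝ}

theorem exists_forall_rsSum (h : HasRSIntegral f g s t I) {ε : ℝ} (hε : 0 < ε) :
    ∃ δ > 0, ∀ S, RSSum f g δ s t S → |S - I| < ε := by
  obtain ⟨δ, hδ, H⟩ := h ε hε
  refine ⟨δ, hδ, fun S hS => ?_⟩
  obtain ⟨m, τ, ξ, h0, hm, hle, hmesh, htag, rfl⟩ := hS.exists_partition
  exact H m τ ξ h0 hm hle hmesh htag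

theorem exists_rsSum (h : HasRSIntegral f g s t I) (hst : s ≤ t) {δ η : ℝ} (hδ : 0 < δ)
    (hη : 0 < η) : ∃ S, RSSum f g δ s t S ∧ |S - I| < η := by
  obtain ⟨δ', hδ', H⟩ := h.exists_forall_rsSum hη
  obtain ⟨S, hS⟩ := RSSum.exists_of_le (f := f) (g := g) hst (lt_min hδ hδ')
  exact ⟨S, hS.mono (min_le_left _ _), H S (hS.mono (min_le_right _ _))⟩

/-- Integrability over `[s, t]` itself is not needed: a fine sum over `[r, s]` close to `I`,
followed by any fine sum over `[s, t]`, is a fine sum over `[r, t]`, hence close to `J`. -/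
theorem exists_rsSum_sub {r J : ℝ} (hI : HasRSIntegral f g r s I) (hJ : HasRSIntegral f g r t J)
    (hrs : r ≤ s) (hst : s ≤ t) {δ η : ℝ} (hδ : 0 < δ) (hη : 0 < η) :
    ∃ S, RSSum f g δ s t S ∧ |S - (J - I)| < η := by
  obtain ⟨δ', hδ', H⟩ := hJ.exists_forall_rsSum (half_pos hη)
  have hm := lt_min hδ hδ'
  obtain ⟨S₁, hS₁, h₁⟩ := hI.exists_rsSum hrs hm (half_pos hη)
  obtain ⟨S₂, hS₂⟩ := RSSum.exists_of_le (f := f) (g := g) hst hm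
  have h := H _ ((hS₁.trans hS₂).mono (min_le_right _ _))
  refine ⟨S₂, hS₂.mono (min_le_left _ _), ?_⟩
  rw [abs_lt] at *
  constructor <;> linarith [h.1, h.2, h₁.1, h₁.2]

theorem eq_zero_of_self (h : HasRSIntegral f g s s I) : I = 0 := by
  by_contra hI
  obtain ⟨δ, -, H⟩ := h.exists_forall_rsSum (abs_pos.2 hI)
  simpa using H 0 .nil

/-- The Saks-Henstock lemma for the Riemann-Stieltjes integral. -/
theorem saks_henstock {J : ℝ → ℝ} (hJ : ∀ t ∈ Set.Icc (0 : ℝ) 1, HasRSIntegral f g 0 t (J t))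
    {ε : ℝ} (hε : 0 < ε) :
    ∃ δ > 0, ∀ (n : ℕ) (p : ℕ → ℝ), p 0 = 0 → p n = 1 → (∀ k ≤ n, p k ∈ Set.Icc (0 : ℝ) 1) →
      (∀ k < n, p k ≤ p (k + 1)) → (∀ k < n, p (k + 1) - p k < δ) →
      ∑ k ∈ Finset.range n,
        |J (p (k + 1)) - J (p k) - f (p k) * (g (p (k + 1)) - g (p k))| ≤ ε := by
  have hε4 : 0 < ε / 4 := by positivity
  obtain ⟨δ, hδ, H⟩ := (hJ 1 (by simp)).exists_forall_rsSum hε4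
  refine ⟨δ, hδ, fun n p h0 h1 hp hle hmesh => ?_⟩
  set d : ℕ → ℝ := fun k =>
    J (p (k + 1)) - J (p k) - f (p k) * (g (p (k + 1)) - g (p k)) with hd
  have hη : 0 < ε / (4 * (n + 1)) := by positivity
  have hex : ∀ k, ∃ S, k < n → RSSum f g δ (p k) (p (k + 1)) S ∧
      |S - (J (p (k + 1)) - J (p k))| < ε / (4 * (n + 1)) := by
    intro k
    by_cases hk : k < n
    · obtain ⟨S, hS⟩ := exists_rsSum_sub (hJ _ (hp k hk.le)) (hJ _ (hp (k + 1) hk))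
        (hp k hk.le).1 (hle k hk) hδ hη
      exact ⟨S, fun _ => hS⟩
    · exact ⟨0, fun h => absurd h hk⟩
  choose S hS using hex
  -- Keep the left-endpoint term on the cells of `A` and use on the others a sum almost equal to the
  -- increment of `J`. The result is a fine sum over `[0, 1]`, so only the defects on `A` survive,
  -- up to `ε / 4 + ε / 4`. Taking for `A` the cells with `0 ≤ d k`, then the others, bounds the sum
  -- of absolute values.
  have key : ∀ A : Finset ℕ, A ⊆ Finset.range n → |∑ k ∈ A, d k| ≤ ε / 2 := by
    intro A hA
    have hT := RSSum.sum (f := f) (g := g) (δ := δ) (p := p) (n := n)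
      (T := fun k => if k ∈ A then f (p k) * (g (p (k + 1)) - g (p k)) else S k) (by
        intro k hk
        by_cases hkA : k ∈ A
        · simpa [hkA] using RSSum.single (hle k hk) (hmesh k hk) (Set.left_mem_Icc.2 (hle k hk))
        · simpa [hkA] using (hS k hk).1)
    rw [h0, h1] at hT
    have hb := H _ hT
    have htel : J 1 = ∑ k ∈ Finset.range n, (J (p (k + 1)) - J (p k)) := by
      rw [Finset.sum_range_sub (fun k => J (p k)), h0, h1,
        (hJ 0 (by simp)).eq_zero_of_self, sub_zero]
    have hdA : ∑ k ∈ A, d k = ∑ k ∈ Finset.range n, if k ∈ A then d k else 0 := by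
      rw [Finset.sum_ite_mem, Finset.inter_eq_right.2 hA]
    have hsplit : ∑ k ∈ A, d k = -((∑ k ∈ Finset.range n,
        if k ∈ A then f (p k) * (g (p (k + 1)) - g (p k)) else S k) - J 1) +
        ∑ k ∈ Finset.range n, (if k ∈ A then 0 else S k - (J (p (k + 1)) - J (p k))) := by
      rw [hdA, htel, ← Finset.sum_sub_distrib, ← Finset.sum_neg_distrib, ← Finset.sum_add_distrib]
      refine Finset.sum_congr rfl fun k _ => ?_
      by_cases hkA : k ∈ A <;> simp [hkA, hd]
    have hrest : |∑ k ∈ Finset.range n,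
        (if k ∈ A then 0 else S k - (J (p (k + 1)) - J (p k)))| ≤ ε / 4 := by
      calc _ ≤ ∑ k ∈ Finset.range n, ε / (4 * (n + 1)) := by
            refine (Finset.abs_sum_le_sum_abs _ _).trans (Finset.sum_le_sum fun k hk => ?_)
            by_cases hkA : k ∈ A
            · simpa [hkA] using hη.le
            · simpa [hkA] using (hS k (Finset.mem_range.1 hk)).2.le
        _ = n * (ε / (4 * (n + 1))) := by simp
        _ ≤ (n + 1) * (ε / (4 * (n + 1))) := by gcongr; linarith
        _ = ε / 4 := by field_simp
    rw [hsplit]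
    refine (abs_add_le _ _).trans ?_
    rw [abs_neg]
    linarith
  have hpos := (abs_le.1 (key _ (Finset.filter_subset (fun k => 0 ≤ d k) _))).2
  have hneg := (abs_le.1 (key _ (Finset.filter_subset (fun k => ¬ 0 ≤ d k) _))).1
  rw [← Finset.sum_filter_add_sum_filter_not _ (fun k => 0 ≤ d k)]
  have e1 : ∑ k ∈ Finset.range n with 0 ≤ d k, |d k| = ∑ k ∈ Finset.range n with 0 ≤ d k, d k :=
    Finset.sum_congr rfl fun k hk => abs_of_nonneg (Finset.mem_filter.1 hk).2
  have e2 : ∑ k ∈ Finset.range n with ¬ 0 ≤ d k, |d k| =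
      -∑ k ∈ Finset.range n with ¬ 0 ≤ d k, d k := by
    rw [← Finset.sum_neg_distrib]
    exact Finset.sum_congr rfl fun k hk => abs_of_neg (not_le.1 (Finset.mem_filter.1 hk).2)
  change (∑ k ∈ Finset.range n with 0 ≤ d k, |d k|) +
    ∑ k ∈ Finset.range n with ¬ 0 ≤ d k, |d k| ≤ ε
  rw [e1, e2]
  linarith

end HasRSIntegral

/-! ### Grid increments and the flow of `σ`. -/

/-- The increment of `b` over the interval `[k / n, (k + 1) / n]`. -/
noncomputable def gridIncrement (b : ℝ → ℝ) (n k : ℕ) : ℝ :=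
  b (((k : ℝ) + 1) / n) - b ((k : ℝ) / n)

theorem sum_gridIncrement (b : ℝ → ℝ) {n : ℕ} (hn : n ≠ 0) :
    ∑ k ∈ Finset.range n, gridIncrement b n k = b 1 - b 0 := by
  have h := Finset.sum_range_sub (fun k : ℕ => b ((k : ℝ) / n)) n
  have hn' : (n : ℝ) ≠ 0 := by exact_mod_cast hn
  simpa [gridIncrement, div_self hn'] using h

/-- The mean value inequality on the segment from `0` to `u`. Iterating it yields Taylor remainders
one order at a time, with the factorials dropped from the constant. -/
theorem abs_le_mul_pow_succ_of_hasDerivAt {f f' : ℝ → ℝ} {M : ℝ} {k : ℕ}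
    (hf : ∀ u, HasDerivAt f (f' u) u) (h0 : f 0 = 0) (hM : 0 ≤ M)
    (hb : ∀ u, |f' u| ≤ M * |u| ^ k) (u : ℝ) : |f u| ≤ M * |u| ^ (k + 1) := by
  have h := (convex_uIcc 0 u).norm_image_sub_le_of_norm_hasDerivWithin_le (f := f) (f' := f')
    (C := M * |u| ^ k) (fun v _ => (hf v).hasDerivWithinAt) (fun v hv => by
      refine (hb v).trans ?_
      have : |v| ≤ |u| := by simpa using Set.abs_sub_left_of_mem_uIcc hv
      gcongr) Set.left_mem_uIcc Set.right_mem_uIcc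
  simp only [h0, sub_zero, Real.norm_eq_abs] at h
  rw [pow_succ, ← mul_assoc]
  exact h

/-- `Λ` is the integral of `1 / σ`. The upper bound on `σ` gives `Λ' ≥ 1 / K > 0`, hence
surjectivity; the inverse function rule then differentiates `φ`. -/
theorem exists_flow {σ : ℝ → ℝ} (hσ : Continuous σ) {c K : ℝ} (hc : 0 < c) (hσc : ∀ x, c ≤ σ x)
    (hσK : ∀ x, σ x ≤ K) :
    ∃ Λ φ : ℝ → ℝ, (∀ x, HasDerivAt Λ (σ x)⁻¹ x) ∧ (∀ x, φ (Λ x) = x) ∧ (∀ y, Λ (φ y) = y) ∧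
      ∀ y, HasDerivAt φ (σ (φ y)) y := by
  have hpos : ∀ x, 0 < σ x := fun x => hc.trans_le (hσc x)
  have hK : 0 < K := (hpos 0).trans_le (hσK 0)
  have hcont : Continuous fun x => (σ x)⁻¹ := hσ.inv₀ fun x => (hpos x).ne'
  set Λ : ℝ → ℝ := fun x => ∫ r in (0 : ℝ)..x, (σ r)⁻¹ with hΛ
  have hd : ∀ x, HasDerivAt Λ (σ x)⁻¹ x := fun x =>
    intervalIntegral.integral_hasDerivAt_right (hcont.intervalIntegrable _ _)
      hcont.stronglyMeasurable.stronglyMeasurableAtFilter hcont.continuousAt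
  have hdiff : Differentiable ℝ Λ := fun x => (hd x).differentiableAt
  have hmono : StrictMono Λ := strictMono_of_deriv_pos fun x => by
    rw [(hd x).deriv]; exact inv_pos.2 (hpos x)
  have hlow : ∀ {x y : ℝ}, x ≤ y → K⁻¹ * (y - x) ≤ Λ y - Λ x := fun {x y} hxy =>
    mul_sub_le_image_sub_of_le_deriv hdiff (fun z => by
      rw [(hd z).deriv]; exact inv_anti₀ (hpos z) (hσK z)) hxy
  have h0 : Λ 0 = 0 := by simp [hΛ]
  have hKi : 0 < K⁻¹ := inv_pos.2 hK
  have hsurj : Function.Surjective Λ := by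
    refine hdiff.continuous.surjective ?_ ?_
    · refine Filter.tendsto_atTop_mono' _ ?_ (Filter.tendsto_id.const_mul_atTop hKi)
      filter_upwards [Filter.eventually_ge_atTop 0] with x hx
      simpa [h0] using hlow hx
    · refine Filter.tendsto_atBot_mono' _ ?_ (Filter.tendsto_id.const_mul_atBot hKi)
      filter_upwards [Filter.eventually_le_atBot 0] with x hx
      have := hlow hx
      simp only [h0, id] at this ⊢
      linarith
  let e := hmono.orderIsoOfSurjective Λ hsurj
  have hr : ∀ y, Λ (e.symm y) = y := fun y => e.apply_symm_apply y
  refine ⟨Λ, e.symm, hd, fun x => e.symm_apply_apply x, hr, fun y => ?_⟩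
  have := HasDerivAt.of_local_left_inverse (f := Λ) (g := e.symm) (a := y)
    e.symm.continuous.continuousAt (hd _) (inv_ne_zero (hpos _).ne')
    (Filter.Eventually.of_forall hr)
  simpa using this

/-! ### Pathwise identification of the solution in the coordinate `Λ`. -/

section Pathwise

variable {σ x b : ℝ → ℝ} {c x₀ : ℝ}

/-- Saks-Henstock controls the `dB` integral, written as `x t - x₀ - F t`; uniform continuity of `c
* σ (x r)` controls the drift integral `F`. -/
theorem sum_abs_increment_sub_le (hσ : Continuous σ) (hx : ContinuousOn x (Set.Icc 0 1))
    (hsol : ∀ t ∈ Set.Icc (0 : ℝ) 1, ∃ I : ℝ, HasRSIntegral (fun r => σ (x r)) b 0 t I ∧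
      x t = x₀ + (∫ r in (0 : ℝ)..t, c * σ (x r)) + I) {ε : ℝ} (hε : 0 < ε) :
    ∃ N : ℕ, 0 < N ∧ ∀ n ≥ N, ∑ k ∈ Finset.range n, |gridIncrement x n k -
      σ (x ((k : ℝ) / n)) * (c * (1 / n) + gridIncrement b n k)| ≤ ε := by
  set f : ℝ → ℝ := fun r => c * σ (x r) with hf
  have hfc : ContinuousOn f (Set.Icc 0 1) := continuousOn_const.mul (hσ.comp_continuousOn hx)
  set F : ℝ → ℝ := fun t => ∫ r in (0 : ℝ)..t, f r with hF
  obtain ⟨δ₁, hδ₁, H₁⟩ := HasRSIntegral.saks_henstock (f := fun r => σ (x r)) (g := b)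
    (J := fun t => x t - x₀ - F t) (fun t ht => by
      obtain ⟨I, hI, hxt⟩ := hsol t ht
      have : x t - x₀ - F t = I := by simp only [hF]; rw [hxt]; ring
      simpa only [this] using hI) (half_pos hε)
  obtain ⟨δ₂, hδ₂, H₂⟩ := Metric.uniformContinuousOn_iff_le.1
    (isCompact_Icc.uniformContinuousOn_of_continuous hfc) _ (half_pos hε)
  obtain ⟨N, hN⟩ := exists_nat_gt (1 / min δ₁ δ₂)
  have hm : 0 < min δ₁ δ₂ := lt_min hδ₁ hδ₂
  have hN0 : (0 : ℝ) < N := (one_div_pos.2 hm).trans hN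
  refine ⟨N, by exact_mod_cast hN0, fun n hn => ?_⟩
  have hnN : (N : ℝ) ≤ n := by exact_mod_cast hn
  have hn0 : (0 : ℝ) < n := hN0.trans_le hnN
  have hmesh : 1 / (n : ℝ) < min δ₁ δ₂ := by
    rw [div_lt_iff₀ hn0]
    rw [div_lt_iff₀ hm] at hN
    nlinarith
  have hmem : ∀ k ≤ n, (k : ℝ) / n ∈ Set.Icc (0 : ℝ) 1 := fun k hk =>
    ⟨by positivity, (div_le_one hn0).2 (by exact_mod_cast hk)⟩
  have hstep : ∀ k : ℕ, ((k + 1 : ℕ) : ℝ) / n - (k : ℝ) / n = 1 / n := fun k => by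
    push_cast; ring
  have hle : ∀ k : ℕ, (k : ℝ) / n ≤ ((k + 1 : ℕ) : ℝ) / n := fun k => by
    rw [← sub_nonneg, hstep]; positivity
  have S₁ := H₁ n (fun k => (k : ℝ) / n) (by simp) (div_self hn0.ne') hmem (fun k _ => hle k)
    (fun k _ => by rw [hstep]; exact hmesh.trans_le (min_le_left _ _))
  have S₂ : ∑ k ∈ Finset.range n,
      |F (((k + 1 : ℕ) : ℝ) / n) - F ((k : ℝ) / n) - f ((k : ℝ) / n) * (1 / n)| ≤ ε / 2 := by
    calc _ ≤ ∑ k ∈ Finset.range n, ε / 2 * (1 / n) := by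
          refine Finset.sum_le_sum fun k hk => ?_
          have hk := Finset.mem_range.1 hk
          have hint : ∀ {u v : ℝ}, u ∈ Set.Icc (0 : ℝ) 1 → v ∈ Set.Icc (0 : ℝ) 1 →
              IntervalIntegrable f volume u v := fun hu hv =>
            (hfc.mono (Set.uIcc_subset_Icc hu hv)).intervalIntegrable
          have h0 : (0 : ℝ) ∈ Set.Icc (0 : ℝ) 1 := by simp
          have hsub := intervalIntegral.integral_interval_sub_left
            (hint h0 (hmem (k + 1) hk)) (hint h0 (hmem k hk.le))
          have hconst : f ((k : ℝ) / n) * (1 / n) =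
              ∫ _ in ((k : ℝ) / n)..(((k + 1 : ℕ) : ℝ) / n), f ((k : ℝ) / n) := by
            rw [intervalIntegral.integral_const, hstep, smul_eq_mul, mul_comm]
          rw [hF, hsub, hconst, ← intervalIntegral.integral_sub (hint (hmem k hk.le)
            (hmem (k + 1) hk)) intervalIntegrable_const]
          have := intervalIntegral.norm_integral_le_of_norm_le_const (a := (k : ℝ) / n)
            (b := ((k + 1 : ℕ) : ℝ) / n) (f := fun r => f r - f ((k : ℝ) / n)) (C := ε / 2) (by
              intro r hr
              rw [Set.uIoc_of_le (hle k)] at hr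
              have hr' : r ∈ Set.Icc (0 : ℝ) 1 :=
                ⟨(hmem k hk.le).1.trans hr.1.le, hr.2.trans (hmem (k + 1) hk).2⟩
              refine H₂ r hr' _ (hmem k hk.le) ?_
              rw [Real.dist_eq, abs_of_nonneg (by linarith [hr.1])]
              linarith [hr.2, hstep k, min_le_right δ₁ δ₂])
          rwa [hstep, abs_of_nonneg (by positivity)] at this
      _ = ε / 2 := by
          rw [Finset.sum_const, Finset.card_range, nsmul_eq_mul]
          field_simp
  have S := add_le_add S₁ S₂
  rw [← Finset.sum_add_distrib, add_halves] at S
  refine (Finset.sum_le_sum fun k _ => ?_).trans S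
  refine le_trans (le_of_eq ?_) (abs_add_le _ _)
  congr 1
  simp only [gridIncrement, hf]
  push_cast
  ring

/-- A substitute for the chain rule: telescope `Λ(x)` over the grid, expand each increment to second
order and insert the Euler increment of `x`, whose total error is small by the preceding lemma. -/
theorem abs_flow_sub_le (hσ : Continuous σ) {c₀ K M : ℝ} {Λ : ℝ → ℝ} (hc₀ : 0 < c₀)
    (hσc : ∀ x, c₀ ≤ σ x) (hσK : ∀ x, σ x ≤ K) (hM : 0 ≤ M)
    (hΛ : ∀ y z, |Λ z - Λ y - (σ y)⁻¹ * (z - y)| ≤ M * |z - y| ^ 2)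
    (hx : ContinuousOn x (Set.Icc 0 1))
    (hsol : ∀ t ∈ Set.Icc (0 : ℝ) 1, ∃ I : ℝ, HasRSIntegral (fun r => σ (x r)) b 0 t I ∧
      x t = x₀ + (∫ r in (0 : ℝ)..t, c * σ (x r)) + I) {ε : ℝ} (hε : 0 < ε) :
    ∃ N : ℕ, ∀ n ≥ N, |Λ (x 1) - Λ x₀ - (c + (b 1 - b 0))| ≤
      ε + 3 * M * K ^ 2 * ∑ k ∈ Finset.range n, gridIncrement b n k ^ 2 := by
  have hx0 : x 0 = x₀ := by
    obtain ⟨I, hI, h⟩ := hsol 0 (by simp)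
    simpa [hI.eq_zero_of_self] using h
  have hA : 0 < 3 * M + c₀⁻¹ := by positivity
  -- The bound `1` gives `q k ^ 2 ≤ q k`, turning squared errors into summable ones; the other bound
  -- makes the term with factor `3 * M + c₀⁻¹` at most `ε / 2`. `N₂` does the same for the squared
  -- drift increments, whose sum is of order `1 / n`.
  obtain ⟨N₁, hN₁, H⟩ := sum_abs_increment_sub_le hσ hx hsol
    (lt_min one_pos (div_pos (half_pos hε) hA))
  obtain ⟨N₂, hN₂⟩ := exists_nat_gt (3 * M * K ^ 2 * c ^ 2 / (ε / 2))
  refine ⟨max N₁ N₂, fun n hn => ?_⟩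
  have hnn : 0 < n := hN₁.trans_le ((le_max_left _ _).trans hn)
  have hn0 : (0 : ℝ) < n := by exact_mod_cast hnn
  have hS := H n ((le_max_left _ _).trans hn)
  set q : ℕ → ℝ := fun k => |gridIncrement x n k -
      σ (x ((k : ℝ) / n)) * (c * (1 / n) + gridIncrement b n k)| with hq
  have hq0 : ∀ k, 0 ≤ q k := fun k => abs_nonneg _
  have hstep : ∀ k ∈ Finset.range n,
      |gridIncrement (fun t => Λ (x t)) n k - (c * (1 / n) + gridIncrement b n k)| ≤
      3 * M * K ^ 2 * c ^ 2 * (1 / n) ^ 2 + 3 * M * K ^ 2 * gridIncrement b n k ^ 2 +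
        (3 * M + c₀⁻¹) * q k := by
    intro k hk
    set y := x ((k : ℝ) / n) with hy
    set w := c * (1 / n) + gridIncrement b n k with hw
    have hσ0 : 0 < σ y := hc₀.trans_le (hσc y)
    have hT := hΛ y (x (((k : ℝ) + 1) / n))
    change |gridIncrement (fun t => Λ (x t)) n k - (σ y)⁻¹ * gridIncrement x n k| ≤
      M * |gridIncrement x n k| ^ 2 at hT
    set r := gridIncrement x n k - σ y * w with hr
    have hqr : q k = |r| := rfl
    have hq1 : q k ≤ 1 := (Finset.single_le_sum (fun i _ => hq0 i) hk).trans
      (hS.trans (min_le_left _ _))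
    have hxr : gridIncrement x n k = σ y * w + r := by rw [hr]; ring
    have hinv : |(σ y)⁻¹ * r| ≤ c₀⁻¹ * q k := by
      rw [abs_mul, abs_of_pos (inv_pos.2 hσ0), hqr]
      gcongr
      exact hσc y
    have hsq : |gridIncrement x n k| ^ 2 ≤
        3 * K ^ 2 * c ^ 2 * (1 / n) ^ 2 + 3 * K ^ 2 * gridIncrement b n k ^ 2 + 3 * q k := by
      have h1 : r ^ 2 ≤ q k := by
        rw [← sq_abs, ← hqr]
        nlinarith [hq0 k]
      have h2 : σ y ^ 2 ≤ K ^ 2 := by have := hσK y; gcongr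
      set u := c * (1 / (n : ℝ)) with hu
      set v := gridIncrement b n k
      have h3 : (u + v) ^ 2 ≤ 2 * (u ^ 2 + v ^ 2) := add_sq_le
      have h4 : σ y ^ 2 * (u ^ 2 + v ^ 2) ≤ K ^ 2 * (u ^ 2 + v ^ 2) := by gcongr
      have h5 : (σ y * u + σ y * v + r) ^ 2 ≤ 3 * ((σ y * u) ^ 2 + (σ y * v) ^ 2 + r ^ 2) := by
        nlinarith [sq_nonneg (σ y * u - σ y * v), sq_nonneg (σ y * u - r),
          sq_nonneg (σ y * v - r)]
      have h6 : σ y * w + r = σ y * u + σ y * v + r := by rw [hw]; ring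
      rw [sq_abs, hxr, h6]
      have h7 : 3 * K ^ 2 * c ^ 2 * (1 / (n : ℝ)) ^ 2 = 3 * K ^ 2 * u ^ 2 := by rw [hu]; ring
      rw [h7]
      nlinarith
    have hdec : gridIncrement (fun t => Λ (x t)) n k - w =
        (gridIncrement (fun t => Λ (x t)) n k - (σ y)⁻¹ * gridIncrement x n k) + (σ y)⁻¹ * r := by
      rw [hxr]
      field_simp
      ring
    rw [hdec]
    refine (abs_add_le _ _).trans ?_
    have := mul_le_mul_of_nonneg_left hsq hM
    linarith
  have htel : Λ (x 1) - Λ x₀ - (c + (b 1 - b 0)) = ∑ k ∈ Finset.range n,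
      (gridIncrement (fun t => Λ (x t)) n k - (c * (1 / n) + gridIncrement b n k)) := by
    rw [Finset.sum_sub_distrib, Finset.sum_add_distrib, sum_gridIncrement _ hnn.ne',
      sum_gridIncrement _ hnn.ne', hx0]
    simp
    field_simp
  rw [htel]
  refine (Finset.abs_sum_le_sum_abs _ _).trans ((Finset.sum_le_sum hstep).trans ?_)
  rw [Finset.sum_add_distrib, Finset.sum_add_distrib, Finset.mul_sum]
  have e1 : ∑ k ∈ Finset.range n, (3 * M + c₀⁻¹) * q k ≤ ε / 2 := by
    have := hS.trans (min_le_right _ _)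
    rw [le_div_iff₀ hA] at this
    rw [← Finset.mul_sum]
    linarith
  have e2 : ∑ _k ∈ Finset.range n, 3 * M * K ^ 2 * c ^ 2 * (1 / (n : ℝ)) ^ 2 ≤ ε / 2 := by
    have h2 : (N₂ : ℝ) ≤ n := by exact_mod_cast (le_max_right _ _).trans hn
    have h3 : 3 * M * K ^ 2 * c ^ 2 / (ε / 2) ≤ n := hN₂.le.trans h2
    rw [div_le_iff₀ (half_pos hε)] at h3
    rw [Finset.sum_const, Finset.card_range, nsmul_eq_mul]
    have : (n : ℝ) * (3 * M * K ^ 2 * c ^ 2 * (1 / (n : ℝ)) ^ 2) = 3 * M * K ^ 2 * c ^ 2 / n := by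
      field_simp
    rw [this, div_le_iff₀ hn0]
    linarith
  linarith

end Pathwise

/-! ### Taylor expansion of the flow and the error of McShane's scheme. -/

/-- Third-order Taylor expansion of the flow of `φ' = σ ∘ φ`. -/
theorem abs_flow_taylor_le {σ σ₁ σ₂ σ₃ φ : ℝ → ℝ} {K : ℝ} (hK : 0 ≤ K)
    (hφ : ∀ y, HasDerivAt φ (σ (φ y)) y)
    (h₀ : ∀ x, HasDerivAt σ (σ₁ x) x) (h₁ : ∀ x, HasDerivAt σ₁ (σ₂ x) x)
    (h₂ : ∀ x, HasDerivAt σ₂ (σ₃ x) x)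
    (b₀ : ∀ x, |σ x| ≤ K) (b₁ : ∀ x, |σ₁ x| ≤ K) (b₂ : ∀ x, |σ₂ x| ≤ K)
    (b₃ : ∀ x, |σ₃ x| ≤ K) (y u : ℝ) :
    |φ (y + u) - (φ y + σ (φ y) * u + 1 / 2 * (σ (φ y) * σ₁ (φ y)) * u ^ 2 +
      1 / 6 * (σ (φ y) ^ 2 * σ₂ (φ y) + σ (φ y) * σ₁ (φ y) ^ 2) * u ^ 3)| ≤
      6 * K ^ 4 * u ^ 4 := by
  have hs : ∀ v, HasDerivAt (fun v => φ (y + v)) (σ (φ (y + v))) v := fun v =>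
    (hφ (y + v)).comp_const_add y v
  have d₀ : ∀ v, HasDerivAt (fun v => σ (φ (y + v))) (σ₁ (φ (y + v)) * σ (φ (y + v))) v :=
    fun v => (h₀ _).comp v (hs v)
  have d₁ : ∀ v, HasDerivAt (fun v => σ₁ (φ (y + v))) (σ₂ (φ (y + v)) * σ (φ (y + v))) v :=
    fun v => (h₁ _).comp v (hs v)
  have d₂ : ∀ v, HasDerivAt (fun v => σ₂ (φ (y + v))) (σ₃ (φ (y + v)) * σ (φ (y + v))) v :=
    fun v => (h₂ _).comp v (hs v)
  have hM : 0 ≤ 6 * K ^ 4 := by positivity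
  set s := σ (φ y)
  set s₁ := σ₁ (φ y)
  set s₂ := σ₂ (φ y)
  -- The fourth derivative of `φ` has coefficients `1 + 4 + 1 = 6` on monomials of degree four in
  -- `σ, σ₁, σ₂, σ₃`, hence `6 * K ^ 4`. The bounds `e3` to `e0` treat the remainders of `φ'''`,
  -- `φ''`, `φ'` and `φ`, each the derivative of the next.
  have e3 := abs_le_mul_pow_succ_of_hasDerivAt (M := 6 * K ^ 4) (k := 0)
    (f := fun v => σ (φ (y + v)) ^ 2 * σ₂ (φ (y + v)) + σ (φ (y + v)) * σ₁ (φ (y + v)) ^ 2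
      - (s ^ 2 * s₂ + s * s₁ ^ 2))
    (f' := fun v => σ (φ (y + v)) * σ₁ (φ (y + v)) ^ 3
      + 4 * (σ (φ (y + v)) ^ 2 * σ₁ (φ (y + v)) * σ₂ (φ (y + v)))
      + σ (φ (y + v)) ^ 3 * σ₃ (φ (y + v)))
    (fun v => by
      convert! ((((d₀ v).pow 2).mul (d₂ v)).add ((d₀ v).mul ((d₁ v).pow 2))).sub_const
        (s ^ 2 * s₂ + s * s₁ ^ 2) using 1
      push_cast
      simp
      ring)
    (by simp [s, s₁, s₂]) hM
    (fun v => by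
      rw [pow_zero, mul_one]
      have q₀ := b₀ (φ (y + v))
      have q₁ := b₁ (φ (y + v))
      have q₂ := b₂ (φ (y + v))
      have q₃ := b₃ (φ (y + v))
      calc _ ≤ |σ (φ (y + v))| * |σ₁ (φ (y + v))| ^ 3
            + 4 * (|σ (φ (y + v))| ^ 2 * |σ₁ (φ (y + v))| * |σ₂ (φ (y + v))|)
            + |σ (φ (y + v))| ^ 3 * |σ₃ (φ (y + v))| := by
            refine (abs_add_three _ _ _).trans (le_of_eq ?_)
            simp [abs_mul]
        _ ≤ K * K ^ 3 + 4 * (K ^ 2 * K * K) + K ^ 3 * K := by gcongr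
        _ = 6 * K ^ 4 := by ring)
  have e2 := abs_le_mul_pow_succ_of_hasDerivAt (M := 6 * K ^ 4) (k := 0 + 1)
    (f := fun v => σ (φ (y + v)) * σ₁ (φ (y + v)) - s * s₁ - (s ^ 2 * s₂ + s * s₁ ^ 2) * v)
    (fun v => by
      convert! (((d₀ v).mul (d₁ v)).sub_const (s * s₁)).sub
        ((hasDerivAt_id v).const_mul (s ^ 2 * s₂ + s * s₁ ^ 2)) using 1
      ring) (by simp [s, s₁]) hM e3
  have e1 := abs_le_mul_pow_succ_of_hasDerivAt (M := 6 * K ^ 4) (k := 0 + 1 + 1)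
    (f := fun v => σ (φ (y + v)) - s - s * s₁ * v - (s ^ 2 * s₂ + s * s₁ ^ 2) * (1 / 2 * v ^ 2))
    (fun v => by
      convert! (((d₀ v).sub_const s).sub ((hasDerivAt_id v).const_mul (s * s₁))).sub
        ((((hasDerivAt_id v).pow 2).const_mul (1 / 2)).const_mul (s ^ 2 * s₂ + s * s₁ ^ 2)) using 1
      simp
      ring) (by simp [s]) hM e2
  have e0 := abs_le_mul_pow_succ_of_hasDerivAt (M := 6 * K ^ 4) (k := 0 + 1 + 1 + 1)
    (f := fun v => φ (y + v) - φ y - s * v - s * s₁ * (1 / 2 * v ^ 2)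
      - (s ^ 2 * s₂ + s * s₁ ^ 2) * (1 / 6 * v ^ 3))
    (fun v => by
      convert! ((((hs v).sub_const (φ y)).sub ((hasDerivAt_id v).const_mul s)).sub
        ((((hasDerivAt_id v).pow 2).const_mul (1 / 2)).const_mul (s * s₁))).sub
        ((((hasDerivAt_id v).pow 3).const_mul (1 / 6)).const_mul (s ^ 2 * s₂ + s * s₁ ^ 2)) using 1
      simp only [id]
      push_cast
      ring) (by simp) hM e1 u
  rw [show |u| ^ (0 + 1 + 1 + 1 + 1) = u ^ 4 from Even.pow_abs (by decide) u] at e0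
  refine le_trans (le_of_eq ?_) e0
  congr 1
  ring

/-- The `A` term is the Taylor remainder and the `D` term the discrepancy of the cubic terms, whose
leading part is `3 c b ^ 2 h`. The mixed term `|b| h ^ 2` is absorbed by `b ^ 2 h + h ^ 3`; `m ≥ 1`
dominates all powers of `|c|` at once. -/
theorem pow_four_add_cube_sub_le {A D m c h b : ℝ} (hA : 0 ≤ A) (hD : 0 ≤ D) (hm : |c| ≤ m)
    (hm1 : 1 ≤ m) (h0 : 0 ≤ h) (h1 : h ≤ 1) :
    A * (c * h + b) ^ 4 + D * |(c * h + b) ^ 3 - b ^ 3| ≤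
      (8 * A * m ^ 4 + 7 * D * m ^ 3) * (b ^ 4 + b ^ 2 * h + h ^ 3) := by
  have hm0 : 0 ≤ m := zero_le_one.trans hm1
  have hbh : 0 ≤ b ^ 2 * h := by positivity
  have h3 : 0 ≤ h ^ 3 := by positivity
  have h43 : h ^ 4 ≤ h ^ 3 := pow_le_pow_of_le_one h0 h1 (by norm_num)
  have hb4 : 0 ≤ b ^ 4 := by positivity
  have c4 : (c * h) ^ 4 ≤ m ^ 4 * h ^ 3 := by
    rw [mul_pow, ← Even.pow_abs (by decide : Even 4) c]
    gcongr
  have m4 : 1 ≤ m ^ 4 := one_le_pow₀ hm1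
  have P4 : (c * h + b) ^ 4 ≤ 8 * m ^ 4 * (b ^ 4 + b ^ 2 * h + h ^ 3) := by
    have : (c * h + b) ^ 4 ≤ 8 * ((c * h) ^ 4 + b ^ 4) := by
      have e1 : (c * h + b) ^ 2 ≤ 2 * ((c * h) ^ 2 + b ^ 2) := add_sq_le
      have e2 : ((c * h) ^ 2 + b ^ 2) ^ 2 ≤ 2 * (((c * h) ^ 2) ^ 2 + (b ^ 2) ^ 2) := add_sq_le
      have e3 : ((c * h + b) ^ 2) ^ 2 ≤ (2 * ((c * h) ^ 2 + b ^ 2)) ^ 2 := by gcongr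
      nlinarith
    have e5 : b ^ 4 ≤ m ^ 4 * b ^ 4 := le_mul_of_one_le_left hb4 m4
    have e6 : 0 ≤ m ^ 4 * (b ^ 2 * h) := by positivity
    nlinarith
  have P3 : |(c * h + b) ^ 3 - b ^ 3| ≤ 7 * m ^ 3 * (b ^ 4 + b ^ 2 * h + h ^ 3) := by
    have e1 : (c * h + b) ^ 3 - b ^ 3 = 3 * (c * (b ^ 2 * h)) + 3 * (c ^ 2 * (b * h ^ 2))
      + c ^ 3 * h ^ 3 := by ring
    have m13 : |c| ≤ m ^ 3 := hm.trans (le_self_pow₀ hm1 (by norm_num))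
    have m23 : |c| ^ 2 ≤ m ^ 3 := (pow_le_pow_left₀ (abs_nonneg c) hm 2).trans
      (pow_le_pow_right₀ hm1 (by norm_num))
    have m33 : |c| ^ 3 ≤ m ^ 3 := pow_le_pow_left₀ (abs_nonneg c) hm 3
    have hb : |b| * h ^ 2 ≤ b ^ 2 * h + h ^ 3 := by
      have : |b| * h ≤ b ^ 2 + h ^ 2 := by nlinarith [sq_nonneg (|b| - h), sq_abs b, abs_nonneg b]
      nlinarith
    rw [e1]
    calc _ ≤ 3 * (|c| * (b ^ 2 * h)) + 3 * (|c| ^ 2 * (|b| * h ^ 2)) + |c| ^ 3 * h ^ 3 := by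
          refine (abs_add_three _ _ _).trans (le_of_eq ?_)
          simp [abs_mul, abs_of_nonneg h0]
      _ ≤ 3 * (m ^ 3 * (b ^ 2 * h)) + 3 * (m ^ 3 * (b ^ 2 * h + h ^ 3)) + m ^ 3 * h ^ 3 := by
          gcongr
      _ ≤ _ := by
          have : 0 ≤ m ^ 3 * b ^ 4 := by positivity
          have : 0 ≤ m ^ 3 * (b ^ 2 * h) := by positivity
          have : 0 ≤ m ^ 3 * h ^ 3 := by positivity
          nlinarith
  have := mul_le_mul_of_nonneg_left P4 hA
  have := mul_le_mul_of_nonneg_left P3 hD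
  linarith

/-- Cauchy-Schwarz over the `n` cells, then over the three terms of each. -/
theorem sq_sum_local_error_le (β : ℕ → ℝ) {n : ℕ} (h : ℝ) :
    (∑ k ∈ Finset.range n, (β k ^ 4 + β k ^ 2 * h + h ^ 3)) ^ 2 ≤
      3 * n * ∑ k ∈ Finset.range n, (β k ^ 8 + β k ^ 4 * h ^ 2 + h ^ 6) := by
  have := sq_sum_le_card_mul_sum_sq (s := Finset.range n)
    (f := fun k => β k ^ 4 + β k ^ 2 * h + h ^ 3)
  rw [Finset.card_range] at this
  refine this.trans ?_
  rw [mul_comm (3 : ℝ), mul_assoc]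
  refine mul_le_mul_of_nonneg_left ?_ n.cast_nonneg
  rw [Finset.mul_sum]
  refine Finset.sum_le_sum fun k _ => ?_
  nlinarith [sq_nonneg (β k ^ 4 - β k ^ 2 * h), sq_nonneg (β k ^ 4 - h ^ 3),
    sq_nonneg (β k ^ 2 * h - h ^ 3)]

section McShane

variable {σ σ₁ σ₂ σ₃ φ Λ : ℝ → ℝ} {K L c : ℝ}

theorem exists_abs_mcShaneStep_sub_le (hK : 0 ≤ K) (hL : 0 ≤ L)
    (hφ : ∀ y, HasDerivAt φ (σ (φ y)) y) (hφΛ : ∀ x, φ (Λ x) = x) (hΛφ : ∀ y, Λ (φ y) = y)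
    (hΛL : ∀ x y, |Λ x - Λ y| ≤ L * |x - y|)
    (h₀ : ∀ x, HasDerivAt σ (σ₁ x) x) (h₁ : ∀ x, HasDerivAt σ₁ (σ₂ x) x)
    (h₂ : ∀ x, HasDerivAt σ₂ (σ₃ x) x)
    (b₀ : ∀ x, |σ x| ≤ K) (b₁ : ∀ x, |σ₁ x| ≤ K) (b₂ : ∀ x, |σ₂ x| ≤ K)
    (b₃ : ∀ x, |σ₃ x| ≤ K) :
    ∃ C : ℝ, 0 ≤ C ∧ ∀ h b x : ℝ, 0 ≤ h → h ≤ 1 →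
      |Λ (mcShaneStep (fun x => c * σ x) σ h b x) - Λ x - (c * h + b)| ≤
        C * (b ^ 4 + b ^ 2 * h + h ^ 3) := by
  have e₁ : deriv σ = σ₁ := funext fun x => (h₀ x).deriv
  have e₂ : iteratedDeriv 2 σ = σ₂ := by
    rw [iteratedDeriv_succ, iteratedDeriv_one, e₁]
    exact funext fun x => (h₁ x).deriv
  have e₃ : ∀ x, deriv (fun x => c * σ x) x = c * σ₁ x := fun x => ((h₀ x).const_mul c).deriv
  set A := 6 * K ^ 4
  set D := 1 / 3 * K ^ 3
  have hA : 0 ≤ A := by positivity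
  have hD : 0 ≤ D := by positivity
  set m := max 1 |c|
  have hm1 : 1 ≤ m := le_max_left _ _
  have hm0 : 0 ≤ m := zero_le_one.trans hm1
  refine ⟨L * (8 * A * m ^ 4 + 7 * D * m ^ 3), by positivity, fun h b x hh0 hh1 => ?_⟩
  have hT := abs_flow_taylor_le hK hφ h₀ h₁ h₂ b₀ b₁ b₂ b₃ (Λ x) (c * h + b)
  rw [hφΛ] at hT
  have hD' : |1 / 6 * (σ x ^ 2 * σ₂ x + σ x * σ₁ x ^ 2)| ≤ D := by
    have q₀ := b₀ x
    have q₁ := b₁ x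
    have q₂ := b₂ x
    have : |σ x ^ 2 * σ₂ x + σ x * σ₁ x ^ 2| ≤ K ^ 2 * K + K * K ^ 2 :=
      calc _ ≤ |σ x| ^ 2 * |σ₂ x| + |σ x| * |σ₁ x| ^ 2 :=
            (abs_add_le _ _).trans (le_of_eq (by simp [abs_mul]))
        _ ≤ _ := by gcongr
    rw [abs_mul, abs_of_pos (by norm_num : (0 : ℝ) < 1 / 6)]
    simp only [D]
    linarith
  have hE : |φ (Λ x + (c * h + b)) - mcShaneStep (fun x => c * σ x) σ h b x| ≤
      A * (c * h + b) ^ 4 + D * |(c * h + b) ^ 3 - b ^ 3| := by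
    -- For `a = c σ` the terms of McShane's step up to second order recombine into powers of `c h +
    -- b`; only the cubic term differs.
    have hs : φ (Λ x + (c * h + b)) - mcShaneStep (fun x => c * σ x) σ h b x =
        (φ (Λ x + (c * h + b)) - (x + σ x * (c * h + b) +
          1 / 2 * (σ x * σ₁ x) * (c * h + b) ^ 2 +
          1 / 6 * (σ x ^ 2 * σ₂ x + σ x * σ₁ x ^ 2) * (c * h + b) ^ 3)) +
        1 / 6 * (σ x ^ 2 * σ₂ x + σ x * σ₁ x ^ 2) * ((c * h + b) ^ 3 - b ^ 3) := by
      rw [mcShaneStep, e₂, e₁, e₃]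
      ring
    rw [hs]
    refine (abs_add_le _ _).trans (add_le_add hT ?_)
    rw [abs_mul]
    gcongr
  have hfin := hΛL (mcShaneStep (fun x => c * σ x) σ h b x) (φ (Λ x + (c * h + b)))
  rw [hΛφ, abs_sub_comm _ (φ _)] at hfin
  rw [sub_sub]
  refine hfin.trans ?_
  rw [mul_assoc]
  exact mul_le_mul_of_nonneg_left
    (hE.trans (pow_four_add_cube_sub_le hA hD (le_max_right _ _) hm1 hh0 hh1)) hL

theorem abs_flow_sub_mcShane_le {C x₀ : ℝ} (hφΛ : ∀ x, φ (Λ x) = x)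
    (hφK : ∀ x y, |φ x - φ y| ≤ K * |x - y|) (hK : 0 ≤ K)
    (hstep : ∀ h b x : ℝ, 0 ≤ h → h ≤ 1 →
      |Λ (mcShaneStep (fun x => c * σ x) σ h b x) - Λ x - (c * h + b)| ≤
        C * (b ^ 4 + b ^ 2 * h + h ^ 3)) (b : ℝ → ℝ) {n : ℕ} (hn : 1 ≤ n) :
    |φ (Λ x₀ + (c + (b 1 - b 0))) - mcShane (fun x => c * σ x) σ x₀ b n n| ≤
      K * (C * ∑ k ∈ Finset.range n, (gridIncrement b n k ^ 4 +
        gridIncrement b n k ^ 2 * (1 / n) + (1 / n) ^ 3)) := by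
  have hn0 : n ≠ 0 := by omega
  have hnr : (n : ℝ) ≠ 0 := by exact_mod_cast hn0
  set Y := mcShane (fun x => c * σ x) σ x₀ b n with hY
  have htel := Finset.sum_range_sub (fun k => Λ (Y k)) n
  have hY0 : Y 0 = x₀ := rfl
  rw [hY0] at htel
  have hsum : ∑ k ∈ Finset.range n, (c * (1 / n) + gridIncrement b n k) = c + (b 1 - b 0) := by
    rw [Finset.sum_add_distrib, sum_gridIncrement _ hn0]
    simp
    field_simp
  have hb : |∑ k ∈ Finset.range n,
      (Λ (Y (k + 1)) - Λ (Y k) - (c * (1 / n) + gridIncrement b n k))| ≤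
      C * ∑ k ∈ Finset.range n, (gridIncrement b n k ^ 4 +
        gridIncrement b n k ^ 2 * (1 / n) + (1 / n) ^ 3) := by
    rw [Finset.mul_sum]
    refine (Finset.abs_sum_le_sum_abs _ _).trans (Finset.sum_le_sum fun k _ => ?_)
    exact hstep (1 / n) (gridIncrement b n k) (Y k) (by positivity)
      (by rw [one_div]; exact Nat.cast_inv_le_one n)
  rw [Finset.sum_sub_distrib, htel, hsum] at hb
  have h := hφK (Λ x₀ + (c + (b 1 - b 0))) (Λ (Y n))
  rw [hφΛ] at h
  refine h.trans (mul_le_mul_of_nonneg_left ?_ hK)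
  rw [abs_sub_comm, ← sub_sub]
  exact hb

end McShane

/-! ### Gaussian moments and increments of fractional Brownian motion. -/

theorem integral_pow_two_mul_of_hasGaussianLaw {Ω : Type*} [MeasurableSpace Ω] {P : Measure Ω}
    {Z : Ω → ℝ} (hZ : HasGaussianLaw Z P) (h0 : ∫ ω, Z ω ∂P = 0) (j : ℕ) :
    ∫ ω, Z ω ^ (2 * j) ∂P = (∫ ω, Z ω ^ 2 ∂P) ^ j * ∫ x, x ^ (2 * j) ∂gaussianReal 0 1 := by
  have hm := hZ.aemeasurable
  have hvar : Var[Z; P] = ∫ ω, Z ω ^ 2 ∂P := variance_of_integral_eq_zero hm h0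
  set v := ∫ ω, Z ω ^ 2 ∂P with hv
  have hv0 : 0 ≤ v := integral_nonneg fun ω => sq_nonneg _
  have hmap : P.map Z = (gaussianReal 0 1).map (fun x => √v * x) := by
    rw [hZ.map_eq_gaussianReal, gaussianReal_map_const_mul, h0, hvar]
    congr 1
    · simp
    · ext
      simp [Real.sq_sqrt hv0, hv0]
  calc ∫ ω, Z ω ^ (2 * j) ∂P = ∫ x, x ^ (2 * j) ∂(P.map Z) := by
        rw [integral_map hm (by fun_prop)]
    _ = ∫ x, (√v * x) ^ (2 * j) ∂gaussianReal 0 1 := by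
        rw [hmap, integral_map (by fun_prop) (by fun_prop)]
    _ = _ := by
        simp_rw [mul_pow]
        rw [integral_const_mul, pow_mul, Real.sq_sqrt hv0]

theorem integrable_pow_of_hasGaussianLaw {Ω : Type*} [MeasurableSpace Ω] {P : Measure Ω}
    {Z : Ω → ℝ} (hZ : HasGaussianLaw Z P) (j : ℕ) : Integrable (fun ω => Z ω ^ j) P := by
  have := hZ.isProbabilityMeasure
  have h := (hZ.memLp (p := j) (by simp)).integrable_norm_pow'
  refine h.mono' (hZ.aemeasurable.pow_const j).aestronglyMeasurable
    (Filter.Eventually.of_forall fun ω => ?_)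
  simp

namespace IsFractionalBrownianMotion

variable {Ω : Type*} [MeasurableSpace Ω] {P : Measure Ω} {H : ℝ} {B : ℝ → Ω → ℝ}

theorem aemeasurable (hB : IsFractionalBrownianMotion P H B) {t : ℝ}
    (ht : t ∈ Set.Icc (0 : ℝ) 1) : AEMeasurable (B t) P :=
  hB.gaussian.aemeasurable ⟨t, ht⟩

theorem hasGaussianLaw_sub (hB : IsFractionalBrownianMotion P H B) {s t : ℝ}
    (hs : s ∈ Set.Icc (0 : ℝ) 1) (ht : t ∈ Set.Icc (0 : ℝ) 1) :
    HasGaussianLaw (fun ω => B t ω - B s ω) P :=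
  hB.gaussian.hasGaussianLaw_fun_sub (s := ⟨t, ht⟩) (t := ⟨s, hs⟩)

theorem integral_sub (hB : IsFractionalBrownianMotion P H B) {s t : ℝ}
    (hs : s ∈ Set.Icc (0 : ℝ) 1) (ht : t ∈ Set.Icc (0 : ℝ) 1) :
    ∫ ω, B t ω - B s ω ∂P = 0 := by
  rw [MeasureTheory.integral_sub (hB.gaussian.hasGaussianLaw_eval ⟨t, ht⟩).integrable
    (hB.gaussian.hasGaussianLaw_eval ⟨s, hs⟩).integrable, hB.centered t ht, hB.centered s hs,
    sub_zero]

theorem integral_sub_sq (hB : IsFractionalBrownianMotion P H B) (hH : 0 < H) {s t : ℝ}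
    (hs : s ∈ Set.Icc (0 : ℝ) 1) (ht : t ∈ Set.Icc (0 : ℝ) 1) :
    ∫ ω, (B t ω - B s ω) ^ 2 ∂P = |t - s| ^ (2 * H) := by
  have ms := (hB.gaussian.hasGaussianLaw_eval ⟨s, hs⟩).memLp_two
  have mt := (hB.gaussian.hasGaussianLaw_eval ⟨t, ht⟩).memLp_two
  have e : ∀ ω, (B t ω - B s ω) ^ 2 = B t ω * B t ω - 2 * (B s ω * B t ω) + B s ω * B s ω :=
    fun ω => by ring
  have hz : (0 : ℝ) ^ (2 * H) = 0 := Real.zero_rpow (by positivity)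
  simp_rw [e]
  have itt : Integrable (fun ω => B t ω * B t ω) P := mt.integrable_mul mt
  have ist : Integrable (fun ω => 2 * (B s ω * B t ω)) P := (ms.integrable_mul mt).const_mul 2
  have iss : Integrable (fun ω => B s ω * B s ω) P := ms.integrable_mul ms
  have isub : Integrable (fun ω => B t ω * B t ω - 2 * (B s ω * B t ω)) P := itt.sub ist
  rw [integral_add isub iss, MeasureTheory.integral_sub itt ist, integral_const_mul,
    hB.covariance_eq t ht t ht,
    hB.covariance_eq s hs t ht, hB.covariance_eq s hs s hs]
  simp only [sub_self, abs_zero, hz]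
  ring

theorem grid_mem {n k : ℕ} (hk : k < n) :
    (k : ℝ) / n ∈ Set.Icc (0 : ℝ) 1 ∧ ((k : ℝ) + 1) / n ∈ Set.Icc (0 : ℝ) 1 := by
  have hn : (0 : ℝ) < n := by exact_mod_cast (by omega : 0 < n)
  have h1 : (k : ℝ) + 1 ≤ n := by exact_mod_cast hk
  refine ⟨⟨by positivity, (div_le_one hn).2 (by linarith)⟩, by positivity, (div_le_one hn).2 h1⟩

theorem hasGaussianLaw_gridIncrement (hB : IsFractionalBrownianMotion P H B) {n k : ℕ}
    (hk : k < n) : HasGaussianLaw (fun ω => gridIncrement (fun t => B t ω) n k) P :=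
  hB.hasGaussianLaw_sub (grid_mem hk).1 (grid_mem hk).2

theorem integral_gridIncrement_sq (hB : IsFractionalBrownianMotion P H B) (hH : 0 < H) {n k : ℕ}
    (hk : k < n) :
    ∫ ω, gridIncrement (fun t => B t ω) n k ^ 2 ∂P = (n : ℝ) ^ (-(2 * H)) := by
  have h := hB.integral_sub_sq hH (grid_mem hk).1 (grid_mem hk).2
  rw [show ((k : ℝ) + 1) / n - (k : ℝ) / n = (n : ℝ)⁻¹ by ring,
    abs_of_nonneg (by positivity), Real.inv_rpow (by positivity),
    ← Real.rpow_neg (by positivity)] at h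
  exact h

theorem integral_gridIncrement_pow (hB : IsFractionalBrownianMotion P H B) (hH : 0 < H)
    {n k : ℕ} (hk : k < n) (j : ℕ) :
    ∫ ω, gridIncrement (fun t => B t ω) n k ^ (2 * j) ∂P =
      ((n : ℝ) ^ (-(2 * H))) ^ j * ∫ x, x ^ (2 * j) ∂gaussianReal 0 1 := by
  rw [integral_pow_two_mul_of_hasGaussianLaw (hB.hasGaussianLaw_gridIncrement hk)
    (hB.integral_sub (grid_mem hk).1 (grid_mem hk).2), hB.integral_gridIncrement_sq hH hk]

/-- For `H > 1 / 2` the quadratic variation of fractional Brownian motion vanishes along a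
subsequence of the uniform grids. -/
theorem exists_seq_quadraticVariation_tendsto_zero (hB : IsFractionalBrownianMotion P H B)
    (hH : 1 / 2 < H) :
    ∃ ns : ℕ → ℕ, StrictMono ns ∧ ∀ᵐ ω ∂P, Filter.Tendsto (fun i => ∑ k ∈ Finset.range (ns i),
      gridIncrement (fun t => B t ω) (ns i) k ^ 2) Filter.atTop (nhds 0) := by
  have hint : ∀ n, ∀ k ∈ Finset.range n,
      Integrable (fun ω => gridIncrement (fun t => B t ω) n k ^ 2) P := fun n k hk =>
    integrable_pow_of_hasGaussianLaw (hB.hasGaussianLaw_gridIncrement (Finset.mem_range.1 hk)) 2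
  have hsum := fun n => integrable_finsetSum _ (hint n)
  -- The sum is nonnegative, so its `L¹` norm is its mean, `n ^ (1 - 2H)`. This tends to zero,
  -- giving convergence in measure and then almost surely along a subsequence.
  have hnorm : ∀ n : ℕ, eLpNorm ((fun ω => ∑ k ∈ Finset.range n,
      gridIncrement (fun t => B t ω) n k ^ 2) - 0) 1 P =
      ENNReal.ofReal (n * (n : ℝ) ^ (-(2 * H))) := by
    intro n
    rw [sub_zero, eLpNorm_one_eq_lintegral_enorm,
      ← ofReal_integral_norm_eq_lintegral_enorm (hsum n)]
    congr 1
    calc _ = ∫ ω, ∑ k ∈ Finset.range n, gridIncrement (fun t => B t ω) n k ^ 2 ∂P :=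
          integral_congr_ae (Filter.Eventually.of_forall fun ω =>
            Real.norm_of_nonneg (Finset.sum_nonneg fun k _ => sq_nonneg _))
      _ = ∑ k ∈ Finset.range n, (n : ℝ) ^ (-(2 * H)) := by
          rw [integral_finsetSum _ (hint n)]
          exact Finset.sum_congr rfl fun k hk =>
            hB.integral_gridIncrement_sq (by linarith) (Finset.mem_range.1 hk)
      _ = _ := by simp
  refine (tendstoInMeasure_of_tendsto_eLpNorm (p := 1) (g := 0) one_ne_zero
    (fun n => (hsum n).aestronglyMeasurable) aestronglyMeasurable_zero ?_).exists_seq_tendsto_ae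
  simp_rw [hnorm]
  rw [← ENNReal.ofReal_zero]
  refine ENNReal.tendsto_ofReal ?_
  have h := (tendsto_rpow_neg_atTop (by linarith : 0 < 2 * H - 1)).comp
    (tendsto_natCast_atTop_atTop (R := ℝ))
  refine h.congr' ?_
  filter_upwards [Filter.eventually_gt_atTop 0] with n hn
  have hn' : (0 : ℝ) < n := by exact_mod_cast hn
  simp only [Function.comp]
  rw [show -(2 * H - 1) = 1 + -(2 * H) by ring, Real.rpow_add hn', Real.rpow_one]

/-- With `v = n ^ (-2H)`, each of the three moments is `O(v ^ 2 n ^ (-2))`: `v ≤ 1 / n` (from `H > 1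
/ 2`) handles the eighth power and `n ^ (-2) ≤ v` (from `H < 1`) handles `h ^ 6`. The `n` cells and
the Cauchy-Schwarz factor `n` then cancel `n ^ (-2)`. -/
theorem integral_sum_local_error_le (hB : IsFractionalBrownianMotion P H B)
    [IsProbabilityMeasure P] (hH : 1 / 2 < H) (hH1 : H < 1) {n : ℕ} (hn : 1 ≤ n) :
    Integrable (fun ω => 3 * (n : ℝ) * ∑ k ∈ Finset.range n, (gridIncrement (fun t => B t ω) n k ^ 8
      + gridIncrement (fun t => B t ω) n k ^ 4 * (1 / (n : ℝ)) ^ 2 + (1 / (n : ℝ)) ^ 6)) P ∧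
    ∫ ω, 3 * (n : ℝ) * ∑ k ∈ Finset.range n, (gridIncrement (fun t => B t ω) n k ^ 8
      + gridIncrement (fun t => B t ω) n k ^ 4 * (1 / (n : ℝ)) ^ 2 + (1 / (n : ℝ)) ^ 6) ∂P ≤
      3 * ((∫ x, x ^ 8 ∂gaussianReal 0 1) + (∫ x, x ^ 4 ∂gaussianReal 0 1) + 1) *
        ((n : ℝ) ^ (-(2 * H))) ^ 2 := by
  have hg := fun k (hk : k ∈ Finset.range n) =>
    hB.hasGaussianLaw_gridIncrement (Finset.mem_range.1 hk)
  have i8 := fun k hk => integrable_pow_of_hasGaussianLaw (hg k hk) 8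
  have i4 := fun k hk => (integrable_pow_of_hasGaussianLaw (hg k hk) 4).mul_const
    ((1 / (n : ℝ)) ^ 2)
  have ic : Integrable (fun _ : Ω => (1 / (n : ℝ)) ^ 6) P := integrable_const _
  have i84 : ∀ k ∈ Finset.range n, Integrable (fun ω => gridIncrement (fun t => B t ω) n k ^ 8
      + gridIncrement (fun t => B t ω) n k ^ 4 * (1 / (n : ℝ)) ^ 2) P := fun k hk =>
    (i8 k hk).add (i4 k hk)
  have i : ∀ k ∈ Finset.range n, Integrable (fun ω => gridIncrement (fun t => B t ω) n k ^ 8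
      + gridIncrement (fun t => B t ω) n k ^ 4 * (1 / (n : ℝ)) ^ 2 + (1 / (n : ℝ)) ^ 6) P :=
    fun k hk => (i84 k hk).add ic
  refine ⟨(integrable_finsetSum _ i).const_mul _, ?_⟩
  rw [integral_const_mul, integral_finsetSum _ i]
  set v := (n : ℝ) ^ (-(2 * H))
  set m8 := ∫ x, x ^ 8 ∂gaussianReal 0 1
  set m4 := ∫ x, x ^ 4 ∂gaussianReal 0 1
  have hm8 : 0 ≤ m8 := integral_nonneg fun x => by positivity
  have hm4 : 0 ≤ m4 := integral_nonneg fun x => by positivity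
  have hn1 : (1 : ℝ) ≤ n := by exact_mod_cast hn
  have hn0 : (0 : ℝ) < n := by linarith
  have hv0 : 0 < v := Real.rpow_pos_of_pos hn0 _
  have hnv : v ≤ 1 / n := by
    rw [one_div, ← Real.rpow_neg_one]
    exact Real.rpow_le_rpow_of_exponent_le hn1 (by linarith)
  have hnv2 : (1 / (n : ℝ)) ^ 2 ≤ v := by
    rw [one_div, inv_pow, ← Real.rpow_natCast, ← Real.rpow_neg hn0.le]
    exact Real.rpow_le_rpow_of_exponent_le hn1 (by push_cast; linarith)
  have hterm : ∀ k ∈ Finset.range n, ∫ ω, (gridIncrement (fun t => B t ω) n k ^ 8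
      + gridIncrement (fun t => B t ω) n k ^ 4 * (1 / (n : ℝ)) ^ 2 + (1 / (n : ℝ)) ^ 6) ∂P ≤
      (m8 + m4 + 1) * (v ^ 2 * (1 / (n : ℝ)) ^ 2) := by
    intro k hk
    have e8 := hB.integral_gridIncrement_pow (by linarith) (Finset.mem_range.1 hk) 4
    have e4 := hB.integral_gridIncrement_pow (by linarith) (Finset.mem_range.1 hk) 2
    norm_num only at e8 e4
    rw [integral_add (i84 k hk) ic, integral_add (i8 k hk) (i4 k hk),
      integral_mul_const, e8, e4, integral_const, probReal_univ, one_smul]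
    change v ^ 4 * m8 + v ^ 2 * m4 * (1 / (n : ℝ)) ^ 2 + (1 / (n : ℝ)) ^ 6 ≤ _
    have f1 : v ^ 4 ≤ v ^ 2 * (1 / (n : ℝ)) ^ 2 := by
      rw [show v ^ 4 = v ^ 2 * v ^ 2 by ring]
      gcongr
    have f2 : (1 / (n : ℝ)) ^ 6 ≤ v ^ 2 * (1 / (n : ℝ)) ^ 2 := by
      rw [show (1 / (n : ℝ)) ^ 6 = ((1 / (n : ℝ)) ^ 2) ^ 2 * (1 / (n : ℝ)) ^ 2 by ring]
      gcongr
    have := mul_le_mul_of_nonneg_right f1 hm8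
    linarith
  calc _ ≤ 3 * (n : ℝ) * ∑ k ∈ Finset.range n, (m8 + m4 + 1) * (v ^ 2 * (1 / (n : ℝ)) ^ 2) := by
        gcongr with k hk
        exact hterm k hk
    _ = _ := by
        rw [Finset.sum_const, Finset.card_range, nsmul_eq_mul]
        field_simp

end IsFractionalBrownianMotion

/-! ### Regularity of `Λ`, proportional coefficients, and the main estimate. -/

theorem abs_sub_le_of_hasDerivAt {f f' : ℝ → ℝ} {M : ℝ} (hM : 0 ≤ M)
    (hf : ∀ u, HasDerivAt f (f' u) u) (hb : ∀ u, |f' u| ≤ M) (x y : ℝ) :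
    |f x - f y| ≤ M * |x - y| := by
  have := abs_le_mul_pow_succ_of_hasDerivAt (f := fun v => f (y + v) - f y)
    (f' := fun v => f' (y + v)) (k := 0) (fun v => ((hf (y + v)).comp_const_add y v).sub_const _)
    (by simp) hM (fun v => by simpa using hb (y + v)) (x - y)
  simpa using this

theorem abs_flow_inverse_taylor_le {σ σ₁ Λ : ℝ → ℝ} {c K : ℝ} (hc : 0 < c) (hσc : ∀ x, c ≤ σ x)
    (hK : 0 ≤ K) (hΛ : ∀ x, HasDerivAt Λ (σ x)⁻¹ x) (h₀ : ∀ x, HasDerivAt σ (σ₁ x) x)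
    (b₁ : ∀ x, |σ₁ x| ≤ K) (y z : ℝ) :
    |Λ z - Λ y - (σ y)⁻¹ * (z - y)| ≤ K / c ^ 2 * |z - y| ^ 2 := by
  have hpos : ∀ x, 0 < σ x := fun x => hc.trans_le (hσc x)
  have hM : 0 ≤ K / c ^ 2 := by positivity
  have h1 : ∀ v, |(σ (y + v))⁻¹ - (σ y)⁻¹| ≤ K / c ^ 2 * |v| ^ (0 + 1) := fun v => by
    have := abs_sub_le_of_hasDerivAt hM (fun x => (h₀ x).inv (hpos x).ne') (fun x => by
      rw [abs_div, abs_neg, abs_of_nonneg (sq_nonneg (σ x))]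
      have := hσc x
      have := b₁ x
      gcongr) (y + v) y
    simpa using this
  have h2 := abs_le_mul_pow_succ_of_hasDerivAt
    (f := fun v => Λ (y + v) - Λ y - (σ y)⁻¹ * v) (fun v => by
      simpa using! ((((hΛ (y + v)).comp_const_add y v).sub_const (Λ y)).sub
        ((hasDerivAt_id v).const_mul (σ y)⁻¹))) (by simp) hM h1 (z - y)
  simpa using h2

theorem exists_eq_const_mul_of_wronskian_eq_zero {a σ : ℝ → ℝ} (ha : Differentiable ℝ a)
    (hσ : Differentiable ℝ σ) (hpos : ∀ x, 0 < σ x)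
    (hcomm : ∀ x, deriv a x * σ x - a x * deriv σ x = 0) : ∃ c, a = fun x => c * σ x := by
  have hd : ∀ x, HasDerivAt (fun x => a x / σ x) 0 x := fun x => by
    have := (ha x).hasDerivAt.fun_div (hσ x).hasDerivAt (hpos x).ne'
    rwa [hcomm, zero_div] at this
  refine ⟨a 0 / σ 0, funext fun x => ?_⟩
  have := is_const_of_deriv_eq_zero (fun x => (hd x).differentiableAt) (fun x => (hd x).deriv) 0 x
  rw [this, div_mul_cancel₀ _ (hpos x).ne']

theorem aemeasurable_mcShane {Ω : Type*} [MeasurableSpace Ω] {P : Measure Ω} {a σ : ℝ → ℝ}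
    (ha : Measurable a) (hσ : Measurable σ) (hσ₂ : Measurable (iteratedDeriv 2 σ)) (x₀ : ℝ)
    {B : ℝ → Ω → ℝ} (hB : ∀ t ∈ Set.Icc (0 : ℝ) 1, AEMeasurable (B t) P) {n k : ℕ} (hk : k ≤ n) :
    AEMeasurable (fun ω => mcShane a σ x₀ (fun t => B t ω) n k) P := by
  induction k with
  | zero => exact aemeasurable_const
  | succ k ih =>
    have ih := ih (by omega)
    have hg := IsFractionalBrownianMotion.grid_mem hk
    have hb : AEMeasurable (fun ω => B (((k : ℝ) + 1) / n) ω - B ((k : ℝ) / n) ω) P :=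
      (hB _ hg.2).sub (hB _ hg.1)
    have hda : Measurable (deriv a) := measurable_deriv a
    have hdσ : Measurable (deriv σ) := measurable_deriv σ
    have hstep : Measurable fun p : ℝ × ℝ => mcShaneStep a σ (1 / (n : ℝ)) p.1 p.2 := by
      unfold mcShaneStep
      fun_prop
    exact hstep.comp_aemeasurable (hb.prodMk ih)

/-- On almost every path, let the grid run along the subsequence with vanishing quadratic variation,
then let `ε` tend to zero. -/
theorem ae_solution_eq {Ω : Type*} [MeasurableSpace Ω] {P : Measure Ω} {H : ℝ} (hH : 1 / 2 < H)
    {B X : ℝ → Ω → ℝ} {σ φ Λ : ℝ → ℝ} {c c₀ K M x₀ : ℝ} (hB : IsFractionalBrownianMotion P H B)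
    (hX : IsPathwiseSolution P (fun x => c * σ x) σ x₀ B X) (hσ : Continuous σ) (hc₀ : 0 < c₀)
    (hσc : ∀ x, c₀ ≤ σ x) (hσK : ∀ x, σ x ≤ K) (hM : 0 ≤ M)
    (hΛ : ∀ y z, |Λ z - Λ y - (σ y)⁻¹ * (z - y)| ≤ M * |z - y| ^ 2) (hφΛ : ∀ x, φ (Λ x) = x) :
    ∀ᵐ ω ∂P, X 1 ω = φ (Λ x₀ + (c + (B 1 ω - B 0 ω))) := by
  obtain ⟨ns, hns, hQ⟩ := hB.exists_seq_quadraticVariation_tendsto_zero hH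
  filter_upwards [hX, hQ] with ω hω hQω
  have hzero : |Λ (X 1 ω) - Λ x₀ - (c + (B 1 ω - B 0 ω))| ≤ 0 := by
    refine le_of_forall_pos_le_add fun ε hε => ?_
    obtain ⟨N, hN⟩ := abs_flow_sub_le hσ hc₀ hσc hσK hM hΛ hω.1 hω.2 hε
    have hlim := (hQω.const_mul (3 * M * K ^ 2)).const_add ε
    rw [mul_zero, add_comm] at hlim
    refine ge_of_tendsto hlim ?_
    filter_upwards [hns.tendsto_atTop.eventually_ge_atTop N] with i hi using hN _ hi
  have := abs_nonpos_iff.1 hzero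
  rw [← hφΛ (X 1 ω)]
  congr 1
  linarith

theorem mainTheorem8
    (H : ℝ) (hH : 1 / 2 < H) (hH1 : H < 1)
    (a σ : ℝ → ℝ) (x₀ : ℝ)
    (ha : ContDiff ℝ 2 a) (hσ : ContDiff ℝ 3 σ)
    (ha_deriv : ∀ k : ℕ, 1 ≤ k → k ≤ 2 → ∃ K : ℝ, ∀ x, |iteratedDeriv k a x| ≤ K)
    (hσ_deriv : ∀ k : ℕ, 1 ≤ k → k ≤ 3 → ∃ K : ℝ, ∀ x, |iteratedDeriv k σ x| ≤ K)
    (ha_bdd : ∃ K : ℝ, ∀ x, |a x| ≤ K) (hσ_bdd : ∃ K : ℝ, ∀ x, |σ x| ≤ K)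
    (hσ_pos : ∃ c : ℝ, 0 < c ∧ ∀ x, c ≤ σ x)
    (hcomm : ∀ x, deriv a x * σ x - a x * deriv σ x = 0) :
    ∃ C : ℝ, 0 < C ∧
      ∀ (Ω : Type*) [MeasurableSpace Ω] (P : Measure Ω) [IsProbabilityMeasure P]
        (B X : ℝ → Ω → ℝ),
        IsFractionalBrownianMotion P H B →
        IsPathwiseSolution P a σ x₀ B X →
        ∀ n : ℕ, 1 ≤ n →
          MemLp (fun ω => X 1 ω - mcShane a σ x₀ (fun t => B t ω) n n) 2 P ∧
          (∫ ω, |X 1 ω - mcShane a σ x₀ (fun t => B t ω) n n| ^ 2 ∂P) ^ ((1 : ℝ) / 2)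
            ≤ C * (n : ℝ) ^ (-(2 * H)) := by
  obtain ⟨c₀, hc₀, hσc⟩ := hσ_pos
  obtain ⟨K₀, hK₀⟩ := hσ_bdd
  obtain ⟨K₁, hK₁⟩ := hσ_deriv 1 le_rfl (by norm_num)
  obtain ⟨K₂, hK₂⟩ := hσ_deriv 2 (by norm_num) (by norm_num)
  obtain ⟨K₃, hK₃⟩ := hσ_deriv 3 (by norm_num) le_rfl
  set K := max (max K₀ K₁) (max K₂ K₃) with hKdef
  have b₀ : ∀ x, |σ x| ≤ K := fun x => (hK₀ x).trans (by simp [hKdef])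
  have b₁ : ∀ x, |iteratedDeriv 1 σ x| ≤ K := fun x => (hK₁ x).trans (by simp [hKdef])
  have b₂ : ∀ x, |iteratedDeriv 2 σ x| ≤ K := fun x => (hK₂ x).trans (by simp [hKdef])
  have b₃ : ∀ x, |iteratedDeriv 3 σ x| ≤ K := fun x => (hK₃ x).trans (by simp [hKdef])
  have hK : 0 ≤ K := (abs_nonneg _).trans (b₀ 0)
  have hpos : ∀ x, 0 < σ x := fun x => hc₀.trans_le (hσc x)
  have hσK : ∀ x, σ x ≤ K := fun x => (le_abs_self _).trans (b₀ x)
  have hder : ∀ k : ℕ, k < 3 → ∀ x,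
      HasDerivAt (iteratedDeriv k σ) (iteratedDeriv (k + 1) σ x) x := fun k hk x => by
    rw [iteratedDeriv_succ]
    exact (hσ.differentiable_iteratedDeriv k (by exact_mod_cast hk) x).hasDerivAt
  have h₀ : ∀ x, HasDerivAt σ (iteratedDeriv 1 σ x) x := by simpa using hder 0 (by norm_num)
  have h₁ := hder 1 (by norm_num)
  have h₂ := hder 2 (by norm_num)
  obtain ⟨c, rfl⟩ := exists_eq_const_mul_of_wronskian_eq_zero (ha.differentiable (by norm_num))
    (hσ.differentiable (by norm_num)) hpos hcomm
  obtain ⟨Λ, φ, hΛ, hφΛ, hΛφ, hφ⟩ := exists_flow hσ.continuous hc₀ hσc hσK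
  have hφK := abs_sub_le_of_hasDerivAt hK hφ fun y => b₀ (φ y)
  have hΛL := abs_sub_le_of_hasDerivAt (inv_nonneg.2 hc₀.le) hΛ fun x => by
    rw [abs_of_pos (inv_pos.2 (hpos x))]
    exact inv_anti₀ hc₀ (hσc x)
  have hΛT := abs_flow_inverse_taylor_le hc₀ hσc hK hΛ h₀ b₁
  obtain ⟨C, hC, hstep⟩ := exists_abs_mcShaneStep_sub_le (c := c) hK (inv_nonneg.2 hc₀.le) hφ hφΛ
    hΛφ hΛL h₀ h₁ h₂ b₀ b₁ b₂ b₃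
  set m := (∫ x, x ^ 8 ∂gaussianReal 0 1) + (∫ x, x ^ 4 ∂gaussianReal 0 1) + 1
  have hm0 : 0 ≤ m := by
    have h8 : 0 ≤ ∫ x, x ^ 8 ∂gaussianReal 0 1 := integral_nonneg fun x => by positivity
    have h4 : 0 ≤ ∫ x, x ^ 4 ∂gaussianReal 0 1 := integral_nonneg fun x => by positivity
    positivity
  -- The summand `1` only makes the constant positive, since `C` may be zero.
  refine ⟨K * C * √(3 * m) + 1, by positivity, ?_⟩
  intro Ω _ P _ B X hB hX n hn
  obtain ⟨hint, hle⟩ := hB.integral_sum_local_error_le hH hH1 hn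
  have hXeq := ae_solution_eq hH hB hX hσ.continuous hc₀ hσc hσK (by positivity) hΛT hφΛ
  set Y : Ω → ℝ := fun ω => mcShane (fun x => c * σ x) σ x₀ (fun t => B t ω) n n
  set G : Ω → ℝ := fun ω => 3 * (n : ℝ) * ∑ k ∈ Finset.range n,
    (gridIncrement (fun t => B t ω) n k ^ 8
      + gridIncrement (fun t => B t ω) n k ^ 4 * (1 / (n : ℝ)) ^ 2 + (1 / (n : ℝ)) ^ 6)
  have hbound : ∀ᵐ ω ∂P, (X 1 ω - Y ω) ^ 2 ≤ (K * C) ^ 2 * G ω := by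
    filter_upwards [hXeq] with ω hω
    have h := abs_flow_sub_mcShane_le (x₀ := x₀) hφΛ hφK hK hstep (fun t => B t ω) hn
    rw [hω, ← sq_abs]
    refine (pow_le_pow_left₀ (abs_nonneg _) h 2).trans ?_
    rw [← mul_assoc, mul_pow]
    gcongr
    exact sq_sum_local_error_le (gridIncrement (fun t => B t ω) n) (1 / (n : ℝ))
  -- Measurability of `X 1` is not assumed; it comes from the almost sure formula through `B 1 - B
  -- 0`.
  have hmeas : AEStronglyMeasurable (fun ω => X 1 ω - Y ω) P := by
    have hφm : Measurable φ :=
      (continuous_iff_continuousAt.2 fun y => (hφ y).continuousAt).measurable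
    have hBm := fun t ht => hB.aemeasurable (t := t) ht
    have h1 : AEMeasurable (fun ω => φ (Λ x₀ + (c + (B 1 ω - B 0 ω)))) P :=
      hφm.comp_aemeasurable ((((hBm 1 (by simp)).sub (hBm 0 (by simp))).const_add c).const_add _)
    have h2 : AEMeasurable Y P := aemeasurable_mcShane ha.continuous.measurable
      hσ.continuous.measurable (hσ.continuous_iteratedDeriv 2 (by norm_num)).measurable x₀ hBm
      le_rfl
    exact ((h1.congr (hXeq.mono fun ω h => h.symm)).sub h2).aestronglyMeasurable
  have hint2 : Integrable (fun ω => (X 1 ω - Y ω) ^ 2) P :=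
    (hint.const_mul ((K * C) ^ 2)).mono' (hmeas.pow 2) (hbound.mono fun ω h => by
      rwa [Real.norm_of_nonneg (sq_nonneg _)])
  refine ⟨(memLp_two_iff_integrable_sq hmeas).2 hint2, ?_⟩
  set v := (n : ℝ) ^ (-(2 * H))
  have hv0 : 0 ≤ v := by positivity
  simp_rw [sq_abs]
  rw [← Real.sqrt_eq_rpow]
  calc √(∫ ω, (X 1 ω - Y ω) ^ 2 ∂P) ≤ √((K * C * √(3 * m) * v) ^ 2) := by
        refine Real.sqrt_le_sqrt ?_
        calc _ ≤ ∫ ω, (K * C) ^ 2 * G ω ∂P := integral_mono_ae hint2 (hint.const_mul _) hbound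
          _ ≤ (K * C) ^ 2 * (3 * m * v ^ 2) := by
              rw [integral_const_mul]
              gcongr
          _ = _ := by
              have hsq : √(3 * m) ^ 2 = 3 * m := Real.sq_sqrt (by positivity)
              linear_combination (-(K * C * v) ^ 2) * hsq
    _ = K * C * √(3 * m) * v := Real.sqrt_sq (by positivity)
    _ ≤ _ := by gcongr; linarith
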